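/- Let $R$ be a ring with $1$ and $M$ an $R$-module that is both Noetherian and Artinian. A constituent of $M$ is a subquotient $A/B$ with $B\subseteq A\subseteq M$ submodules, taken as placed inside $M$ (not up to isomorphism). Let $T/N$ be a subquotient and $F$ a submodule of $M$: we say that $T/N$ lies in $F$ if $T=N+(T\cap F)$, and that it lies over $F$ if $T\cap F\subseteq N$. A quotient $T/P$ with $P\subseteq N\subseteq T$ splits over $N$ if $N+K=T$, $N\cap K=P$ for some submodule $K$. Diagrams. Let $D$ be a finite directed graph without loops, multiple edges or directed cycles, whose edges are thought of as pointing down. A set $U$ of vertices is open if every edge starting in $U$ ends in $U$. Write $\downarrow x$ for the set of vertices reachable from $x$ by directed paths ($x$ included) and $\uparrow y$ for the set of vertices from which $y$ is reachable. A diagram of the constituent $A/B$ is such a graph $D$ with a submodule $G(U)$, $B\subseteq G(U)\subseteq A$, for every open $U$, such that: (a) $G(\emptyset)=B$, $G(D)=A$, $G(U\cup W)=G(U)+G(W)$, $G(U\cap W)=G(U)\cap G(W)$, and $G(U\cup\{x\})/G(U)$ is simple whenever $x\notin U$ and $U$, $U\cup\{x\}$ are open (this is the simple constituent at $x$); (b)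 downward fans are not cleaved by submodules: if $W_1\subsetneq W_2\subsetneq{\downarrow}x$ are open, then $G({\downarrow}x)/G(W_1)$ does not split over $G(W_2)$; upward fans are not cleaved by quotients: if $D\setminus{\uparrow}y\subsetneq W_1\subsetneq W_2$ are open, then $G(W_2)/G(D\setminus{\uparrow}y)$ does not split over $G(W_1)$; (c) every edge $x\to y$ represents a non-split extension: there are submodules $B\subseteq P\subseteq N\subseteq T\subseteq A$ such that $N/P$ is placed at $y$, $T/N$ is placed at $x$, and $T/P$ does not split over $N$. Here a simple constituent is placed at the vertex $x$ if, for every open $U$, it lies in $G(U)$ when $x\in U$ and lies over $G(U)$ when $x\notin U$. A virtual diagram $\mathfrak D$ of $M$ is a diagram of $M=M/0$, with submodules $F(U)$, that is satiated: it is not a proper subgraph of another diagram of $M$ in which the constituents at its vertices are placed at the same vertices. A subdiagram of $\mathfrak D$ is the full subgraph on a set $D$ of vertices. It is realizable if it corresponds to some constituent $A/B$ of $M$, i.e. if $D$ is a diagram of $A/B$ for some submodules $G(U)$ such that, for each $x\in D$, the simple constituents $G(U\cup\{x\})/G(U)$ are placed at $x$ in $\mathfrak D$. The vertex $x$ is in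 the radical layer $i$ if its constituent $F({\downarrow}x)/F({\downarrow}x\setminus\{x\})$ lies in $\operatorname{rad}^iM$ and over $\operatorname{rad}^{i+1}M$. A generalized monotone path from $x$ to $y$ is a sequence $K_0=\{x\},K_1,\dots,K_m=\{y\}$ of realizable sets of vertices (generalized vertices, which may represent non-simple constituents), with $a_i,b_i\in K_i$ such that $b_i$ is reachable from $a_i$ by a directed path in $K_i$ and there is an edge $b_i\to a_{i+1}$ for each $i<m$. Proposition. Let $\mathfrak D$ be a virtual diagram of $M$ and $D$ a connected (non-empty) subdiagram of it. Then $D$ is realizable if and only if there is no generalized monotone path that joins two vertices of $D$ in different radical layers and has a generalized vertex $K_i$ outside $D$ (i.e. $K_i\cap D=\emptyset$). -/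

import Mathlib

/-!
Conventions.  `R` is a ring, `M` an `R`-module, `V` the vertex set of an oriented graph with edge
relation `e` (`e x y` : there is an edge going down from `x` to `y`).

A constituent `A / B` of `M` (a submodule of a subquotient of `M`, placed inside `M` and not taken
up to isomorphism) is written as the pair of submodules `B ≤ A` of `M`.  Submodules of `A / B` are
the submodules of `M` between `B` and `A`.
-/

namespace VirtualDiagrams

universe u v w

section Graph

variable {V : Type w}

/-- The edges of the subdiagram with vertex set `D`: an edge belongs to it iff both its ends do. -/
def EdgeIn (e : V → V → Prop) (D : Set V) (x y : V) : Prop :=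
  x ∈ D ∧ y ∈ D ∧ e x y

/-- `U` is an open subdiagram of `D`: it is closed under going down along edges of `D`. -/
def IsOpenIn (e : V → V → Prop) (D U : Set V) : Prop :=
  U ⊆ D ∧ ∀ x y, EdgeIn e D x y → x ∈ U → y ∈ U

/-- The vertices of `D` reached from `x` by going down inside `D` (`x` included). -/
def below (e : V → V → Prop) (D : Set V) (x : V) : Set V :=
  {z | Relation.ReflTransGen (EdgeIn e D) x z}

/-- The vertices of `D` reached from `x` by going down at least one edge of `D`. -/
def strictBelow (e : V → V → Prop) (D : Set V) (x : V) : Set V :=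
  {z | Relation.TransGen (EdgeIn e D) x z}

/-- The vertices of `D` from which one cannot reach `y` by going down inside `D`. -/
def notAbove (e : V → V → Prop) (D : Set V) (y : V) : Set V :=
  {z | z ∈ D ∧ ¬ Relation.ReflTransGen (EdgeIn e D) z y}

/-- The subdiagram of `e` with vertex set `D` is connected (in particular non-empty). -/
def IsConnectedSubdiagram (e : V → V → Prop) (D : Set V) : Prop :=
  ((SimpleGraph.fromRel e).induce D).Connected

end Graph

section Diagram

variable {R : Type u} [Ring R] {M : Type v} [AddCommGroup M] [Module R M] {V : Type w}

/-- The extension `T / P` of `T / N` by `N / P` splits. -/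
def Splits (P N T : Submodule R M) : Prop :=
  ∃ K : Submodule R M, N ⊔ K = T ∧ N ⊓ K = P

/-- Let `G` attach a submodule of `M` to every open subdiagram of `D`.  The simple constituent
`T / N` is placed at the vertex `x` of `D` if, for every open `U`,
* when `x ∈ U`, it is a constituent of the submodule `G U`, by the identification
  `T / N = (N + (T ∩ G U)) / N = (T ∩ G U) / (N ∩ G U)`;
* when `x ∉ U`, it is a constituent of the quotient modulo `G U`, by the identification
  `T / N = T / (T ∩ (N + G U)) = (T + G U) / (N + G U)`. -/
def PlacedAt (e : V → V → Prop) (D : Set V) (G : Set V → Submodule R M)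
    (N T : Submodule R M) (x : V) : Prop :=
  N ⋖ T ∧ ∀ U, IsOpenIn e D U →
    (x ∈ U → T ≤ N ⊔ (T ⊓ G U)) ∧ (x ∉ U → T ⊓ G U ≤ N)

/-- The graph `e` on the vertex set `D` is a diagram of the constituent `A / B`, its open
subdiagrams `U` being realized by the submodules `G U / B` of `A / B` and their (closed)
complements by the quotients `A / G U`.  Only the values of `G` on open subdiagrams matter. -/
structure IsDiagramOf (e : V → V → Prop) (D : Set V) (B A : Submodule R M)
    (G : Set V → Submodule R M) : Prop where
  /-- the graph is directed downwards -/
  acyclic : ∀ x, ¬ Relation.TransGen (EdgeIn e D) x x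
  bot : G ∅ = B
  top : G D = A
  sup : ∀ U W, IsOpenIn e D U → IsOpenIn e D W → G (U ∪ W) = G U ⊔ G W
  inf : ∀ U W, IsOpenIn e D U → IsOpenIn e D W → G (U ∩ W) = G U ⊓ G W
  /-- the vertices are simple constituents -/
  simple : ∀ U x, IsOpenIn e D U → IsOpenIn e D (insert x U) → x ∉ U → G U ⋖ G (insert x U)
  /-- Taking submodules does not cleave a downward fan: in the generalized fan with head node `x`
  and vertex set `below x \ W₁`, the proper subfan `below x \ W₂` (which still contains `x`, and
  which is the quotient `G (below x) / G W₂`) is not a submodule. -/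
  downward_fan : ∀ x ∈ D, ∀ W₁ W₂, IsOpenIn e D W₁ → IsOpenIn e D W₂ → W₁ ⊂ W₂ →
    W₂ ⊂ below e D x → ¬ Splits (G W₁) (G W₂) (G (below e D x))
  /-- Taking quotients does not cleave an upward fan: in the generalized fan with basis node `y`
  and vertex set `W₂ \ notAbove y`, the proper subfan `W₁ \ notAbove y` (which still contains `y`,
  and which is the submodule `G W₁ / G (notAbove y)`) is not a quotient. -/
  upward_fan : ∀ y ∈ D, ∀ W₁ W₂, IsOpenIn e D W₁ → IsOpenIn e D W₂ → notAbove e D y ⊂ W₁ →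
    W₁ ⊂ W₂ → ¬ Splits (G (notAbove e D y)) (G W₁) (G W₂)
  /-- every edge represents a non-split extension inside `A / B` -/
  edge : ∀ x y, EdgeIn e D x y → ∃ P N T : Submodule R M, B ≤ P ∧ T ≤ A ∧
    PlacedAt e D G P N y ∧ PlacedAt e D G N T x ∧ ¬ Splits P N T

/-- The diagram given by `e`, `F` on `V` is a proper subdiagram (proper subgraph with the same
virtual correspondence of its vertices) of the diagram given by `e'`, `F'` on `V'`. -/
def IsProperSubdiagramOf {V' : Type w} (e : V → V → Prop) (F : Set V → Submodule R M)
    (e' : V' → V' → Prop) (F' : Set V' → Submodule R M) : Prop :=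
  ∃ φ : V ↪ V', (∀ x y, e x y → e' (φ x) (φ y)) ∧
    (∀ x, PlacedAt e' Set.univ F' (F (strictBelow e Set.univ x)) (F (below e Set.univ x)) (φ x)) ∧
    ((∃ z, z ∉ Set.range φ) ∨ ∃ x y, e' (φ x) (φ y) ∧ ¬ e x y)

variable (R M V) in
/-- A virtual diagram of the module `M` with vertex set `V`. -/
structure VirtualDiagram where
  /-- `edge x y` : an edge going down from `x` to `y` -/
  edge : V → V → Prop
  /-- the submodules of `M` realizing the open subdiagrams -/
  sub : Set V → Submodule R M
  isDiagram : IsDiagramOf edge Set.univ ⊥ ⊤ sub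
  satiety : ¬ ∃ (V' : Type w) (e' : V' → V' → Prop) (F' : Set V' → Submodule R M),
    Finite V' ∧ IsDiagramOf e' Set.univ ⊥ ⊤ F' ∧ IsProperSubdiagramOf edge sub e' F'

variable (R M) in
/-- The radical powers `rad^i M`; `rad^(i+1) M` is the radical of the module `rad^i M`. -/
noncomputable def radPow : ℕ → Submodule R M
  | 0 => ⊤
  | i + 1 => (Module.jacobson R (radPow i)).map (radPow i).subtype

namespace VirtualDiagram

variable (𝔇 : VirtualDiagram R M V)

/-- The simple constituent of `M` at the vertex `x` belongs to the layer
`rad^i M / rad^(i+1) M` (so `i = 0` is the head of `M`). -/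
def InRadicalLayer (x : V) (i : ℕ) : Prop :=
  let T := 𝔇.sub (below 𝔇.edge Set.univ x)
  let N := 𝔇.sub (strictBelow 𝔇.edge Set.univ x)
  T ≤ N ⊔ (T ⊓ radPow R M i) ∧ T ⊓ radPow R M (i + 1) ≤ N

/-- The vertices `x` and `y` are in different radical layers. -/
def InDifferentLayers (x y : V) : Prop :=
  ∃ i j, 𝔇.InRadicalLayer x i ∧ 𝔇.InRadicalLayer y j ∧ i ≠ j

/-- The constituent `A / B` of `M` corresponds to the subdiagram `D`: with the same virtual
correspondence of its vertices, `D` is a diagram of `A / B`. -/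
def Realizes (B A : Submodule R M) (D : Set V) : Prop :=
  ∃ G : Set V → Submodule R M, IsDiagramOf 𝔇.edge D B A G ∧
    ∀ U x, IsOpenIn 𝔇.edge D U → IsOpenIn 𝔇.edge D (insert x U) → x ∉ U →
      PlacedAt 𝔇.edge Set.univ 𝔇.sub (G U) (G (insert x U)) x

/-- The subdiagram `D` corresponds to some constituent of `M`. -/
def Realizable (D : Set V) : Prop :=
  ∃ B A : Submodule R M, B ≤ A ∧ 𝔇.Realizes B A D

/-- `K 0, …, K m` is a generalized monotone path from the vertex `x` down to the vertex `y`: its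
(generalized) vertices are sets of vertices that represent not necessarily simple constituents,
and the path enters `K i` at `a i`, goes down to `b i` in `K i`, and leaves along an edge from
`b i` down to `a (i+1)`. -/
def IsGeneralizedPath (x y : V) (m : ℕ) (K : Fin (m + 1) → Set V) : Prop :=
  K 0 = {x} ∧ K (Fin.last m) = {y} ∧ (∀ i, 𝔇.Realizable (K i)) ∧
    ∃ a b : Fin (m + 1) → V,
      (∀ i, a i ∈ K i ∧ b i ∈ K i ∧ Relation.ReflTransGen (EdgeIn 𝔇.edge (K i)) (a i) (b i)) ∧
      ∀ i : Fin m, 𝔇.edge (b i.castSucc) (a i.succ)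

end VirtualDiagram

end Diagram

end VirtualDiagrams

namespace VirtualDiagrams

universe u v w

/-! ### Open sets, convex sets and lower hulls -/

section Graph

variable {V : Type w} {e : V → V → Prop} {D U W : Set V}

/-! Both sides of the equivalence say that `D` is convex: a directed path between two of its
vertices stays in `D`.

The engine is a reformulation of the fan axioms. Since downward fans are not cleaved, the submodule
at `below x` is local modulo `B`, with maximal submodule at `strictBelow x` (`below_le_of_le_sup`);
dually, the quotient by the submodule at `notAbove y` is colocal (`le_notAbove_of_inf_le`).

If `D` is convex with lower hull `H`, then `H \ D` is open and `F(H)/F(H \ D)` realizes `D`; the fan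
axioms pass to it by locality and colocality, the edges by the modular law (`IsDiagramOf.restrict`).
Conversely, in a realization `G` of `D` inside `A/B`, each vertex generates `B + F(below x)` and
cogenerates `A ∩ F(notAbove y)`. A vertex `z` outside `D` but between two vertices of `D` would then
satisfy `F(below z) ≤ B`, which is impossible above a vertex of `D` (`Realizable.isConvex`).

A generalized path enters each of its sets at a vertex of a directed path with the same ends, and a
directed path is a generalized path of singletons. The ends of a nontrivial directed path are always
in different radical layers, because the maximal submodule of a local submodule of `rad^i M` lies in
`rad^(i+1) M`. -/

theorem IsOpenIn.union (hU : IsOpenIn e D U) (hW : IsOpenIn e D W) : IsOpenIn e D (U ∪ W) :=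
  ⟨Set.union_subset hU.1 hW.1, fun x y h hx => hx.imp (hU.2 x y h) (hW.2 x y h)⟩

theorem IsOpenIn.inter (hU : IsOpenIn e D U) (hW : IsOpenIn e D W) : IsOpenIn e D (U ∩ W) :=
  ⟨fun _ h => hU.1 h.1, fun x y h hx => ⟨hU.2 x y h hx.1, hW.2 x y h hx.2⟩⟩

theorem isOpenIn_empty : IsOpenIn e D ∅ := ⟨Set.empty_subset _, fun _ _ _ h => h.elim⟩

theorem isOpenIn_self : IsOpenIn e D D := ⟨subset_rfl, fun _ _ h _ => h.2.1⟩

theorem IsOpenIn.mem_of_reach (hU : IsOpenIn e D U) {x y : V} (hx : x ∈ U)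
    (h : Relation.ReflTransGen (EdgeIn e D) x y) : y ∈ U := by
  induction h with
  | refl => exact hx
  | tail _ h ih => exact hU.2 _ _ h ih

theorem mem_below (x : V) : x ∈ below e D x := Relation.ReflTransGen.refl

theorem IsOpenIn.below_subset (hU : IsOpenIn e D U) {x : V} (hx : x ∈ U) : below e D x ⊆ U :=
  fun _ h => hU.mem_of_reach hx h

theorem isOpenIn_below {x : V} (hx : x ∈ D) : IsOpenIn e D (below e D x) :=
  ⟨isOpenIn_self.below_subset hx, fun _ _ h hz => Relation.ReflTransGen.tail hz h⟩

theorem isOpenIn_strictBelow (x : V) : IsOpenIn e D (strictBelow e D x) :=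
  ⟨fun _ h => by
      obtain ⟨_, _, h⟩ := Relation.TransGen.tail'_iff.1 h
      exact h.2.1,
    fun _ _ h hz => Relation.TransGen.tail hz h⟩

theorem insert_strictBelow (x : V) : insert x (strictBelow e D x) = below e D x := by
  ext z
  simp only [Set.mem_insert_iff, strictBelow, below, Set.mem_ofPred_eq]
  rw [Relation.reflTransGen_iff_eq_or_transGen]

theorem strictBelow_subset_below (x : V) : strictBelow e D x ⊆ below e D x :=
  fun _ h => Relation.TransGen.to_reflTransGen h

theorem isOpenIn_notAbove (y : V) : IsOpenIn e D (notAbove e D y) :=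
  ⟨fun _ h => h.1, fun _ _ h hx => ⟨h.2.1, fun h' => hx.2 (h'.head h)⟩⟩

theorem isOpenIn_insert_notAbove {y : V} (hy : y ∈ D)
    (hac : ∀ x, ¬ Relation.TransGen (EdgeIn e D) x x) :
    IsOpenIn e D (insert y (notAbove e D y)) := by
  refine ⟨Set.insert_subset hy fun _ h => h.1, fun x z h hx => ?_⟩
  rcases hx with rfl | hx
  · exact Or.inr ⟨h.2.1, fun h' => hac _ (Relation.TransGen.head' h h')⟩
  · exact Or.inr ((isOpenIn_notAbove y).2 _ _ h hx)

theorem notMem_notAbove (y : V) : y ∉ notAbove e D y := fun h => h.2 Relation.ReflTransGen.refl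

/-- An open set avoiding `y` consists of vertices not above `y`. -/
theorem IsOpenIn.subset_notAbove (hU : IsOpenIn e D U) {y : V} (hy : y ∉ U) :
    U ⊆ notAbove e D y :=
  fun _ h => ⟨hU.1 h, fun h' => hy (hU.mem_of_reach h h')⟩

theorem reach_mono (hDU : D ⊆ U) {x y : V} (h : Relation.ReflTransGen (EdgeIn e D) x y) :
    Relation.ReflTransGen (EdgeIn e U) x y :=
  Relation.ReflTransGen.mono (fun _ _ h => ⟨hDU h.1, hDU h.2.1, h.2.2⟩) _ _ h

/-- A set of vertices containing every directed path between two of its vertices. -/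
def IsConvex (e : V → V → Prop) (D : Set V) : Prop :=
  ∀ x ∈ D, ∀ y ∈ D, ∀ z, Relation.ReflTransGen (EdgeIn e Set.univ) x z →
    Relation.ReflTransGen (EdgeIn e Set.univ) z y → z ∈ D

/-- The vertices reached from `D`. -/
def lowerHull (e : V → V → Prop) (D : Set V) : Set V :=
  {z | ∃ x ∈ D, Relation.ReflTransGen (EdgeIn e Set.univ) x z}

theorem subset_lowerHull : D ⊆ lowerHull e D := fun x hx => ⟨x, hx, Relation.ReflTransGen.refl⟩

theorem isOpenIn_lowerHull : IsOpenIn e Set.univ (lowerHull e D) :=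
  ⟨Set.subset_univ _, fun _ _ h ⟨d, hd, h'⟩ => ⟨d, hd, h'.tail h⟩⟩

/-- Convexity is what forbids an edge from the hull outside `D` back into `D`; this is how open sets
of `D` become open sets of the whole graph. -/
theorem IsOpenIn.union_lowerHull_diff (hD : IsConvex e D) (hU : IsOpenIn e D U) :
    IsOpenIn e Set.univ (U ∪ lowerHull e D \ D) := by
  refine ⟨Set.subset_univ _, fun x y h hx => ?_⟩
  have hy : y ∈ lowerHull e D := by
    refine isOpenIn_lowerHull.2 _ _ h ?_
    exact hx.elim (fun h => subset_lowerHull (hU.1 h)) fun h => h.1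
  by_cases hyD : y ∈ D
  · rcases hx with hx | ⟨⟨d, hd, hdx⟩, hx⟩
    · exact Or.inl (hU.2 _ _ ⟨hU.1 hx, hyD, h.2.2⟩ hx)
    · exact absurd (hD d hd y hyD x hdx (Relation.ReflTransGen.single h)) hx
  · exact Or.inr ⟨hy, hyD⟩

theorem IsOpenIn.union_lowerHull_diff_subset (hU : IsOpenIn e D U) :
    U ∪ lowerHull e D \ D ⊆ lowerHull e D :=
  Set.union_subset (hU.1.trans subset_lowerHull) Set.sdiff_subset

theorem IsConvex.isOpenIn_lowerHull_diff (hD : IsConvex e D) :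
    IsOpenIn e Set.univ (lowerHull e D \ D) := by
  simpa using isOpenIn_empty.union_lowerHull_diff hD

/-- A directed path as a sequence of vertices. -/
theorem exists_seq_of_reach {x y : V} (h : Relation.ReflTransGen (EdgeIn e D) x y) :
    ∃ (m : ℕ) (p : ℕ → V), p 0 = x ∧ p m = y ∧ ∀ i < m, e (p i) (p (i + 1)) := by
  induction h using Relation.ReflTransGen.head_induction_on with
  | refl => exact ⟨0, fun _ => y, rfl, rfl, by simp⟩
  | @head a c h _ ih =>
    obtain ⟨m, p, h0, hm, hp⟩ := ih
    refine ⟨m + 1, fun i => Nat.casesOn i a p, rfl, hm, fun i hi => ?_⟩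
    cases i with
    | zero => simpa [h0] using h.2.2
    | succ i => exact hp i (by omega)

end Graph

section Diagram

variable {R : Type u} [Ring R] {M : Type v} [AddCommGroup M] [Module R M] {V : Type w}
variable {e : V → V → Prop} {D U W : Set V} {A B : Submodule R M} {G : Set V → Submodule R M}

/-! ### Locality and colocality in a diagram -/

namespace IsDiagramOf

theorem mono (h : IsDiagramOf e D B A G) (hU : IsOpenIn e D U) (hW : IsOpenIn e D W)
    (hUW : U ⊆ W) : G U ≤ G W := by
  rw [← Set.union_eq_self_of_subset_left hUW, h.sup U W hU hW]
  exact le_sup_left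

theorem lower_le (h : IsDiagramOf e D B A G) (hU : IsOpenIn e D U) : B ≤ G U :=
  h.bot ▸ h.mono isOpenIn_empty hU (Set.empty_subset _)

theorem le_upper (h : IsDiagramOf e D B A G) (hU : IsOpenIn e D U) : G U ≤ A :=
  h.top ▸ h.mono hU isOpenIn_self hU.1

theorem notMem_strictBelow (h : IsDiagramOf e D B A G) (x : V) : x ∉ strictBelow e D x :=
  h.acyclic x

theorem strictBelow_covBy (h : IsDiagramOf e D B A G) {x : V} (hx : x ∈ D) :
    G (strictBelow e D x) ⋖ G (below e D x) := by
  rw [← insert_strictBelow]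
  refine h.simple _ x (isOpenIn_strictBelow x) ?_ (h.notMem_strictBelow x)
  rw [insert_strictBelow]
  exact isOpenIn_below hx

theorem notAbove_covBy (h : IsDiagramOf e D B A G) {y : V} (hy : y ∈ D) :
    G (notAbove e D y) ⋖ G (insert y (notAbove e D y)) :=
  h.simple _ y (isOpenIn_notAbove y) (isOpenIn_insert_notAbove hy h.acyclic) (notMem_notAbove y)

/-- For `z` in `U` but not in `W`, the hypothesis would force `G (below z) ≤ G (below z ∩ W) ≤ G
(strictBelow z)`, against the simplicity of the constituent at `z`. -/
theorem subset_of_le (h : IsDiagramOf e D B A G) (hU : IsOpenIn e D U) (hW : IsOpenIn e D W)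
    (hle : G U ≤ G W) : U ⊆ W := by
  intro z hz
  by_contra hzW
  have hzD := hU.1 hz
  have h1 : G (below e D z) ≤ G (below e D z ∩ W) := by
    rw [h.inf _ _ (isOpenIn_below hzD) hW]
    exact le_inf le_rfl ((h.mono (isOpenIn_below hzD) hU (hU.below_subset hz)).trans hle)
  have h2 : below e D z ∩ W ⊆ strictBelow e D z := by
    rintro v ⟨hv, hvW⟩
    rw [← insert_strictBelow] at hv
    rcases hv with rfl | hv
    · exact absurd hvW hzW
    · exact hv
  exact (h.strictBelow_covBy hzD).lt.not_ge
    (h1.trans (h.mono ((isOpenIn_below hzD).inter hW) (isOpenIn_strictBelow z) h2))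

/-- The submodule of `A / B` generated by a vertex is local. -/
theorem below_le_of_le_sup [Finite V] (h : IsDiagramOf e D B A G) {x : V} (hx : x ∈ D)
    {K : Submodule R M} (hBK : B ≤ K) (hK : G (below e D x) ≤ G (strictBelow e D x) ⊔ K) :
    G (below e D x) ≤ K := by
  have hXo : IsOpenIn e D (below e D x) := isOpenIn_below hx
  have hX'o : IsOpenIn e D (strictBelow e D x) := isOpenIn_strictBelow x
  have hX'X : G (strictBelow e D x) ≤ G (below e D x) := (h.strictBelow_covBy hx).le
  obtain ⟨L, hL⟩ : ∃ L, L = K ⊓ G (below e D x) := ⟨_, rfl⟩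
  have hBL : B ≤ L := hL ▸ le_inf hBK (h.lower_le hXo)
  have hLX : L ≤ G (below e D x) := hL ▸ inf_le_right
  suffices G (below e D x) ≤ L from this.trans (hL ▸ inf_le_left)
  by_contra hcon
  -- A minimal open `O` that still supplements `L` is nonempty; deleting a top vertex `z` of it will
  -- exhibit a cleaved fan.
  let S : Set (Set V) := {O | IsOpenIn e D O ∧ O ⊆ strictBelow e D x ∧ G (below e D x) ≤ G O ⊔ L}
  have hS : S.Nonempty := by
    refine ⟨strictBelow e D x, hX'o, subset_rfl, ?_⟩
    rw [hL, ← sup_inf_assoc_of_le _ hX'X]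
    exact le_inf hK le_rfl
  obtain ⟨O, hO⟩ := S.toFinite.exists_minimal hS
  obtain ⟨hOo, hOx, hOL⟩ := hO.prop
  have hne : O.Nonempty := by
    rw [Set.nonempty_iff_ne_empty]
    rintro rfl
    rw [h.bot, sup_eq_right.2 hBL] at hOL
    exact hcon hOL
  obtain ⟨z, hzO, hz⟩ : ∃ z ∈ O, ∀ v ∈ O, ¬ Relation.TransGen (EdgeIn e D) v z := by
    have : Std.Irrefl (Relation.TransGen (EdgeIn e D)) := ⟨h.acyclic⟩
    have hwf : WellFounded (Relation.TransGen (EdgeIn e D)) :=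
      Finite.wellFounded_of_trans_of_irrefl _
    exact ⟨hwf.min O hne, hwf.min_mem O hne, fun v hv => hwf.not_lt_min O hv⟩
  have hO'o : IsOpenIn e D (O \ {z}) :=
    ⟨Set.sdiff_subset.trans hOo.1, fun a b hab ha =>
      ⟨hOo.2 a b hab ha.1, fun hb => hz a ha.1 (Relation.TransGen.single (hb ▸ hab))⟩⟩
  have hins : insert z (O \ {z}) = O := by simp [hzO]
  have hcov : G (O \ {z}) ⋖ G O := by
    have := h.simple (O \ {z}) z hO'o (hins.symm ▸ hOo) (by simp)
    rwa [hins] at this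
  have hnot : ¬ G (below e D x) ≤ G (O \ {z}) ⊔ L := fun hc =>
    (hO.le_of_le ⟨hO'o, Set.sdiff_subset.trans hOx, hc⟩ Set.sdiff_subset hzO).2 rfl
  have hOX : O ⊆ below e D x := hOx.trans (strictBelow_subset_below x)
  -- By simplicity at `z`, this complement meets `G O` either in `G (O \ {z})`, as wanted, or in all
  -- of `G O`, against the minimality of `O`.
  refine h.downward_fan x hx (O \ {z}) O hO'o hOo ?_ ?_ ⟨G (O \ {z}) ⊔ L, ?_, ?_⟩
  · exact ⟨Set.sdiff_subset, fun hc => (hc hzO).2 rfl⟩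
  · exact ⟨hOX, fun hc => h.notMem_strictBelow x (hOx (hc (mem_below x)))⟩
  · rw [← sup_assoc, sup_eq_left.2 hcov.le]
    exact le_antisymm (sup_le (h.mono hOo hXo hOX) hLX) hOL
  · rcases hcov.eq_or_eq (le_inf hcov.le le_sup_left)
      (inf_le_left : G O ⊓ (G (O \ {z}) ⊔ L) ≤ G O) with hc | hc
    · exact hc
    · exact absurd (hOL.trans (sup_le (inf_eq_left.1 hc) le_sup_right)) hnot

/-- The quotient of `A / B` cogenerated by a vertex is colocal. -/
theorem le_notAbove_of_inf_le [Finite V] (h : IsDiagramOf e D B A G) {y : V} (hy : y ∈ D)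
    {K : Submodule R M} (hKA : K ≤ A)
    (hK : K ⊓ G (insert y (notAbove e D y)) ≤ G (notAbove e D y)) :
    K ≤ G (notAbove e D y) := by
  have hYo : IsOpenIn e D (notAbove e D y) := isOpenIn_notAbove y
  have hY'o : IsOpenIn e D (insert y (notAbove e D y)) := isOpenIn_insert_notAbove hy h.acyclic
  have hYY' : G (notAbove e D y) ≤ G (insert y (notAbove e D y)) := (h.notAbove_covBy hy).le
  obtain ⟨L, hL⟩ : ∃ L, L = G (notAbove e D y) ⊔ K := ⟨_, rfl⟩
  have hLA : L ≤ A := hL ▸ sup_le (h.le_upper hYo) hKA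
  have hYL : G (notAbove e D y) ≤ L := hL ▸ le_sup_left
  suffices L ≤ G (notAbove e D y) from le_trans (hL ▸ le_sup_right) this
  by_contra hcon
  -- Dual choice: a maximal open `O` with `L ⊓ G O` still inside `G (notAbove y)`, enlarged below by
  -- a bottom vertex `z` of its complement.
  let S : Set (Set V) :=
    {O | IsOpenIn e D O ∧ insert y (notAbove e D y) ⊆ O ∧ L ⊓ G O ≤ G (notAbove e D y)}
  have hS : S.Nonempty := by
    refine ⟨_, hY'o, subset_rfl, ?_⟩
    rw [hL, sup_inf_assoc_of_le _ hYY']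
    exact sup_le le_rfl hK
  obtain ⟨O, hO⟩ := S.toFinite.exists_maximal hS
  obtain ⟨hOo, hOy, hOL⟩ := hO.prop
  have hne : (D \ O).Nonempty := by
    rw [Set.sdiff_nonempty]
    intro hc
    rw [hOo.1.antisymm hc, h.top, inf_eq_left.2 hLA] at hOL
    exact hcon hOL
  obtain ⟨z, ⟨hzD, hzO⟩, hz⟩ :
      ∃ z ∈ D \ O, ∀ v ∈ D \ O, ¬ Relation.TransGen (EdgeIn e D) z v := by
    have : Std.Irrefl (flip (Relation.TransGen (EdgeIn e D))) := ⟨h.acyclic⟩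
    have : IsTrans V (flip (Relation.TransGen (EdgeIn e D))) := ⟨fun _ _ _ h₁ h₂ => h₂.trans h₁⟩
    have hwf : WellFounded (flip (Relation.TransGen (EdgeIn e D))) :=
      Finite.wellFounded_of_trans_of_irrefl _
    exact ⟨hwf.min _ hne, hwf.min_mem _ hne, fun v hv => hwf.not_lt_min _ hv⟩
  have hO'o : IsOpenIn e D (insert z O) := by
    refine ⟨Set.insert_subset hzD hOo.1, fun a b hab ha => ?_⟩
    rcases ha with rfl | ha
    · by_contra hb
      exact hz b ⟨hab.2.1, fun hc => hb (Or.inr hc)⟩ (Relation.TransGen.single hab)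
    · exact Or.inr (hOo.2 a b hab ha)
  have hcov : G O ⋖ G (insert z O) := h.simple O z hOo hO'o hzO
  have hnot : ¬ L ⊓ G (insert z O) ≤ G (notAbove e D y) := fun hc =>
    hzO (hO.le_of_ge ⟨hO'o, hOy.trans (Set.subset_insert _ _), hc⟩ (Set.subset_insert _ _)
      (Set.mem_insert _ _))
  have hYO : G (notAbove e D y) ≤ G O := h.mono hYo hOo ((Set.subset_insert _ _).trans hOy)
  refine h.upward_fan y hy O (insert z O) hOo hO'o ?_ ?_ ⟨L ⊓ G (insert z O), ?_, ?_⟩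
  · exact ⟨(Set.subset_insert _ _).trans hOy,
      fun hc => notMem_notAbove y (hc (hOy (Set.mem_insert _ _)))⟩
  · exact ⟨Set.subset_insert _ _, fun hc => hzO (hc (Set.mem_insert _ _))⟩
  · rcases hcov.eq_or_eq le_sup_left (sup_le hcov.le inf_le_right :
      G O ⊔ L ⊓ G (insert z O) ≤ G (insert z O)) with hc | hc
    · exact absurd ((le_inf inf_le_left (sup_eq_left.1 hc)).trans hOL) hnot
    · exact hc
  · refine le_antisymm ((le_inf (inf_le_right.trans inf_le_left) inf_le_left).trans hOL) ?_
    exact le_inf hYO (le_inf hYL (hYO.trans hcov.le))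

/-- `G U` is generated by the vertices of `U`. -/
theorem le_of_below_le [Finite V] (h : IsDiagramOf e D B A G) (hU : IsOpenIn e D U)
    {Q : Submodule R M} (hB : B ≤ Q) (hQ : ∀ x ∈ U, G (below e D x) ≤ Q) : G U ≤ Q := by
  have key : ∀ S : Set V, S ⊆ U →
      IsOpenIn e D (⋃ x ∈ S, below e D x) ∧ G (⋃ x ∈ S, below e D x) ≤ Q := by
    intro S
    induction S, S.toFinite using Set.Finite.induction_on with
    | empty => simpa [h.bot, isOpenIn_empty] using hB
    | @insert a S _ _ ih =>
      intro hS
      obtain ⟨ih₁, ih₂⟩ := ih ((Set.subset_insert _ _).trans hS)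
      have ha : a ∈ U := hS (Set.mem_insert _ _)
      have hao : IsOpenIn e D (below e D a) := isOpenIn_below (hU.1 ha)
      rw [Set.biUnion_insert]
      refine ⟨hao.union ih₁, ?_⟩
      rw [h.sup _ _ hao ih₁]
      exact sup_le (hQ a ha) ih₂
  obtain ⟨h₁, h₂⟩ := key U subset_rfl
  exact (h.mono hU h₁ fun x hx => Set.mem_biUnion hx (mem_below x)).trans h₂

/-- `G U` is cogenerated by the vertices outside `U`. -/
theorem le_of_le_notAbove [Finite V] (h : IsDiagramOf e D B A G) (hU : IsOpenIn e D U)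
    {Q : Submodule R M} (hA : Q ≤ A) (hQ : ∀ y ∈ D, y ∉ U → Q ≤ G (notAbove e D y)) :
    Q ≤ G U := by
  -- The factor `D` makes the empty intersection equal to `D`, where `G` takes the value `A`.
  have key : ∀ S : Set V, S ⊆ D \ U →
      IsOpenIn e D (D ∩ ⋂ y ∈ S, notAbove e D y) ∧ Q ≤ G (D ∩ ⋂ y ∈ S, notAbove e D y) := by
    intro S
    induction S, S.toFinite using Set.Finite.induction_on with
    | empty => simpa [h.top, isOpenIn_self] using hA
    | @insert a S _ _ ih =>
      intro hS
      obtain ⟨ih₁, ih₂⟩ := ih ((Set.subset_insert _ _).trans hS)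
      have ha : a ∈ D \ U := hS (Set.mem_insert _ _)
      have hao : IsOpenIn e D (notAbove e D a) := isOpenIn_notAbove a
      rw [Set.biInter_insert, Set.inter_left_comm]
      refine ⟨hao.inter ih₁, ?_⟩
      rw [h.inf _ _ hao ih₁]
      exact le_inf (hQ a ha.1 ha.2) ih₂
  obtain ⟨h₁, h₂⟩ := key (D \ U) subset_rfl
  refine h₂.trans (h.mono h₁ hU fun x hx => ?_)
  by_contra hxU
  exact notMem_notAbove x (Set.mem_iInter₂.1 hx.2 x ⟨hx.1, hxU⟩)

theorem placedAt_insert (h : IsDiagramOf e D B A G) {x : V} (hU : IsOpenIn e D U)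
    (hxU : IsOpenIn e D (insert x U)) (hx : x ∉ U) :
    PlacedAt e D G (G U) (G (insert x U)) x := by
  refine ⟨h.simple U x hU hxU hx, fun O hO => ?_⟩
  rw [← h.inf _ _ hxU hO]
  refine ⟨fun hxO => ?_, fun hxO => ?_⟩
  · rw [← h.sup _ _ hU (hxU.inter hO)]
    refine h.mono hxU (hU.union (hxU.inter hO)) ?_
    rintro v (rfl | hv)
    · exact Or.inr ⟨Set.mem_insert _ _, hxO⟩
    · exact Or.inl hv
  · refine h.mono (hxU.inter hO) hU ?_
    rintro v ⟨rfl | hv, hvO⟩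
    · exact absurd hvO hxO
    · exact hv

end IsDiagramOf

/-! ### Restriction of a diagram to a convex set -/

section Convex

variable {F : Set V → Submodule R M}

/-- Intersecting with `F(H)` keeps the constituent simple because it lies in `F(H)`; adding `F(H \
D)` does so because it lies over `F(H \ D)`. Both are instances of the modular law. -/
theorem PlacedAt.restrict (h : IsDiagramOf e Set.univ ⊥ ⊤ F) (hD : IsConvex e D)
    {N T : Submodule R M} {x : V} (hx : x ∈ D) (hp : PlacedAt e Set.univ F N T x) :
    PlacedAt e D (fun O => F (O ∪ lowerHull e D \ D))
      (N ⊓ F (lowerHull e D) ⊔ F (lowerHull e D \ D))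
      (T ⊓ F (lowerHull e D) ⊔ F (lowerHull e D \ D)) x := by
  have hHo : IsOpenIn e Set.univ (lowerHull e D) := isOpenIn_lowerHull
  have hCo := hD.isOpenIn_lowerHull_diff
  have hT := (hp.2 _ hHo).1 (subset_lowerHull hx)
  have hN := (hp.2 _ hCo).2 fun h => h.2 hx
  have hNT : N ≤ T := hp.1.le
  refine ⟨?_, fun O hO => ?_⟩
  · have h₁ : N ⊓ F (lowerHull e D) ⋖ T ⊓ F (lowerHull e D) := by
      have h₂ : N ⊔ T ⊓ F (lowerHull e D) = T := le_antisymm (sup_le hNT inf_le_left) hT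
      have h₃ : N ⊓ (T ⊓ F (lowerHull e D)) = N ⊓ F (lowerHull e D) := by
        rw [← inf_assoc, inf_eq_left.2 hNT]
      rw [← h₃]
      apply IsLowerModularLattice.inf_covBy_of_covBy_sup
      rw [h₂]
      exact hp.1
    have h₂ : T ⊓ F (lowerHull e D) ⊓ (N ⊓ F (lowerHull e D) ⊔ F (lowerHull e D \ D)) =
        N ⊓ F (lowerHull e D) := by
      refine le_antisymm ?_ (le_inf h₁.le le_sup_left)
      rw [inf_comm, sup_inf_assoc_of_le _ h₁.le]
      refine sup_le le_rfl (le_inf ?_ (inf_le_right.trans inf_le_right))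
      exact (le_inf (inf_le_right.trans inf_le_left) inf_le_left).trans hN
    have h₃ : T ⊓ F (lowerHull e D) ⊔ F (lowerHull e D \ D) =
        T ⊓ F (lowerHull e D) ⊔ (N ⊓ F (lowerHull e D) ⊔ F (lowerHull e D \ D)) := by
      rw [← sup_assoc, sup_eq_left.2 h₁.le]
    rw [h₃]
    apply IsUpperModularLattice.covBy_sup_of_inf_covBy
    rw [h₂]
    exact h₁
  · have hOo := hO.union_lowerHull_diff hD
    have hCO : F (lowerHull e D \ D) ≤ F (O ∪ lowerHull e D \ D) :=
      h.mono hCo hOo Set.subset_union_right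
    have hOH : F (O ∪ lowerHull e D \ D) ≤ F (lowerHull e D) :=
      h.mono hOo hHo hO.union_lowerHull_diff_subset
    refine ⟨fun hxO => ?_, fun hxO => ?_⟩
    · refine sup_le ?_ (le_sup_right.trans le_sup_left)
      calc T ⊓ F (lowerHull e D)
          ≤ (T ⊓ F (O ∪ lowerHull e D \ D) ⊔ N) ⊓ F (lowerHull e D) :=
            inf_le_inf_right _ (((hp.2 _ hOo).1 (Or.inl hxO)).trans (sup_comm _ _).le)
        _ = T ⊓ F (O ∪ lowerHull e D \ D) ⊔ N ⊓ F (lowerHull e D) :=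
            sup_inf_assoc_of_le _ (inf_le_right.trans hOH)
        _ ≤ _ := by
            refine sup_le (le_trans ?_ le_sup_right) (le_sup_left.trans le_sup_left)
            exact le_inf (le_trans (inf_le_inf_left _ hOH) le_sup_left) inf_le_right
    · change (T ⊓ F (lowerHull e D) ⊔ F (lowerHull e D \ D)) ⊓ F (O ∪ lowerHull e D \ D) ≤ _
      rw [sup_comm, sup_inf_assoc_of_le _ hCO]
      refine sup_le le_sup_right (le_trans (le_inf ?_ ?_) le_sup_left)
      · refine le_trans (inf_le_inf_right _ inf_le_left) ((hp.2 _ hOo).2 ?_)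
        rintro (hc | hc)
        · exact hxO hc
        · exact hc.2 hx
      · exact inf_le_left.trans inf_le_right

/-- A complement `K` of the restricted extension lifts to the complement `P ⊔ K ⊓ T` of the original
one. -/
theorem not_splits_restrict {P N T H C : Submodule R M} (hPN : P ≤ N) (hNT : N ≤ T)
    (hT : T ≤ N ⊔ T ⊓ H) (hN : N ⊓ C ≤ P) (hCH : C ≤ H) (hs : ¬ Splits P N T) :
    ¬ Splits (P ⊓ H ⊔ C) (N ⊓ H ⊔ C) (T ⊓ H ⊔ C) := by
  rintro ⟨K, hK₁, hK₂⟩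
  have hCK : C ≤ K := le_trans (le_sup_right.trans hK₂.ge) inf_le_right
  have hKH : K ≤ H := le_trans (le_sup_right.trans hK₁.le) (sup_le inf_le_right hCH)
  refine hs ⟨P ⊔ K ⊓ T, ?_, ?_⟩
  · refine le_antisymm (sup_le hNT (sup_le (hPN.trans hNT) inf_le_right)) ?_
    refine hT.trans (sup_le le_sup_left ?_)
    calc T ⊓ H ≤ (N ⊓ H ⊔ K) ⊓ T := by
          refine le_inf ((le_sup_left.trans hK₁.ge).trans ?_) inf_le_left
          exact sup_le (sup_le le_sup_left (hCK.trans le_sup_right)) le_sup_right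
      _ = N ⊓ H ⊔ K ⊓ T := sup_inf_assoc_of_le _ (inf_le_left.trans hNT)
      _ ≤ _ := sup_le_sup inf_le_left le_sup_right
  · rw [inf_comm, sup_inf_assoc_of_le _ hPN]
    refine le_antisymm (sup_le le_rfl ?_) le_sup_left
    have h₁ : K ⊓ T ⊓ N ≤ P ⊓ H ⊔ C := by
      rw [← hK₂]
      refine le_inf ?_ (inf_le_left.trans inf_le_left)
      exact (le_inf inf_le_right (inf_le_left.trans (inf_le_left.trans hKH))).trans le_sup_left
    calc K ⊓ T ⊓ N ≤ (P ⊓ H ⊔ C) ⊓ N := le_inf h₁ inf_le_right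
      _ = P ⊓ H ⊔ C ⊓ N := sup_inf_assoc_of_le _ (inf_le_left.trans hPN)
      _ ≤ P := sup_le inf_le_left (inf_comm C N ▸ hN)

/-- A convex set of vertices is a diagram of the corresponding constituent. -/
theorem IsDiagramOf.restrict [Finite V] (h : IsDiagramOf e Set.univ ⊥ ⊤ F) (hD : IsConvex e D) :
    IsDiagramOf e D (F (lowerHull e D \ D)) (F (lowerHull e D))
      (fun O => F (O ∪ lowerHull e D \ D)) where
  acyclic x hx :=
    h.acyclic x (Relation.TransGen.mono (fun _ _ h => ⟨trivial, trivial, h.2.2⟩) _ _ hx)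
  bot := by simp
  top := by
    rw [Set.union_sdiff_cancel subset_lowerHull]
  sup U W hU hW := by
    rw [Set.union_union_distrib_right]
    exact h.sup _ _ (hU.union_lowerHull_diff hD) (hW.union_lowerHull_diff hD)
  inf U W hU hW := by
    rw [Set.inter_union_distrib_right]
    exact h.inf _ _ (hU.union_lowerHull_diff hD) (hW.union_lowerHull_diff hD)
  simple U x hU hxU hx := by
    have h₁ := hxU.union_lowerHull_diff hD
    change F (U ∪ lowerHull e D \ D) ⋖ F (insert x U ∪ lowerHull e D \ D)
    rw [Set.insert_union] at h₁ ⊢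
    refine h.simple _ x (hU.union_lowerHull_diff hD) h₁ ?_
    rintro (hc | hc)
    · exact hx hc
    · exact hc.2 (hxU.1 (Set.mem_insert _ _))
  downward_fan := by
    rintro x hx W₁ W₂ h₁ h₂ h₁₂ h₂x ⟨K, hK₁, hK₂⟩
    have hCo := hD.isOpenIn_lowerHull_diff
    have hxo : IsOpenIn e Set.univ (below e Set.univ x) := isOpenIn_below trivial
    have hxo' : IsOpenIn e Set.univ (strictBelow e Set.univ x) := isOpenIn_strictBelow x
    have h₁o := h₁.union_lowerHull_diff hD
    have h₂o := h₂.union_lowerHull_diff hD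
    have hDo := (isOpenIn_below (e := e) hx).union_lowerHull_diff hD
    have hbelow : below e Set.univ x ⊆ below e D x ∪ lowerHull e D \ D :=
      hDo.below_subset (Or.inl (mem_below x))
    have hCK : F (lowerHull e D \ D) ≤ K :=
      (h.mono hCo h₁o Set.subset_union_right).trans (hK₂.ge.trans inf_le_right)
    have hW₂ : W₂ ∪ lowerHull e D \ D ⊆ strictBelow e Set.univ x ∪ lowerHull e D \ D := by
      refine Set.union_subset_union_left _ fun v hv => ?_
      have hv' : v ∈ below e Set.univ x := reach_mono (Set.subset_univ _) (h₂x.1 hv)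
      rw [← insert_strictBelow] at hv'
      refine hv'.resolve_left ?_
      rintro rfl
      exact h₂x.2 (h₂.below_subset hv)
    have hW₂K : F (W₂ ∪ lowerHull e D \ D) ≤ F (strictBelow e Set.univ x) ⊔ K := by
      refine (h.mono h₂o (hxo'.union hCo) hW₂).trans ?_
      rw [h.sup _ _ hxo' hCo]
      exact sup_le_sup_left hCK _
    -- Locality in `M` puts the whole of `F (below x)` into the complement `K`. Then `K` also
    -- contains `F (W₂ ∪ H \ D)`, which forces `W₂ ⊆ W₁`.
    have hxK : F (below e Set.univ x) ≤ K := by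
      refine h.below_le_of_le_sup trivial bot_le ?_
      exact (h.mono hxo hDo hbelow).trans (hK₁.ge.trans (sup_le hW₂K le_sup_right))
    have hW₂K' : F (W₂ ∪ lowerHull e D \ D) ≤ K := hW₂K.trans
      (sup_le ((h.mono hxo' hxo (strictBelow_subset_below x)).trans hxK) le_rfl)
    have hsub := h.subset_of_le h₂o h₁o ((le_inf le_rfl hW₂K').trans hK₂.le)
    refine h₁₂.2 fun v hv => (hsub (Or.inl hv)).resolve_right fun hc => hc.2 (h₂.1 hv)
  upward_fan := by
    rintro y hy W₁ W₂ h₁ h₂ hy₁ h₁₂ ⟨K, hK₁, hK₂⟩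
    have hHo : IsOpenIn e Set.univ (lowerHull e D) := isOpenIn_lowerHull
    have hyo : IsOpenIn e Set.univ (notAbove e Set.univ y) := isOpenIn_notAbove y
    have hyo' : IsOpenIn e Set.univ (insert y (notAbove e Set.univ y)) :=
      isOpenIn_insert_notAbove trivial h.acyclic
    have h₁o := h₁.union_lowerHull_diff hD
    have h₂o := h₂.union_lowerHull_diff hD
    have hDo := (isOpenIn_notAbove (e := e) (D := D) y).union_lowerHull_diff hD
    have hyW₁ : y ∈ W₁ := by
      obtain ⟨v, hv, hvy⟩ := Set.exists_of_ssubset hy₁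
      by_contra hc
      exact hvy (h₁.subset_notAbove hc hv)
    have hKH : K ≤ F (lowerHull e D) :=
      (le_sup_right.trans hK₁.le).trans (h.mono h₂o hHo h₂.union_lowerHull_diff_subset)
    have hsub : notAbove e Set.univ y ∩ lowerHull e D ⊆ notAbove e D y ∪ lowerHull e D \ D := by
      rintro v ⟨hv, hvH⟩
      by_cases hvD : v ∈ D
      · exact Or.inl ⟨hvD, fun hc => hv.2 (reach_mono (Set.subset_univ _) hc)⟩
      · exact Or.inr ⟨hvH, hvD⟩
    have hsub' : insert y (notAbove e Set.univ y) ∩ lowerHull e D ⊆ W₁ ∪ lowerHull e D \ D := by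
      rintro v ⟨rfl | hv, hvH⟩
      · exact Or.inl hyW₁
      · exact (hsub ⟨hv, hvH⟩).imp_left fun hc => hy₁.1 hc
    have hDy : notAbove e D y ∪ lowerHull e D \ D ⊆ notAbove e Set.univ y := by
      refine hDo.subset_notAbove ?_
      rintro (hc | hc)
      · exact notMem_notAbove y hc
      · exact hc.2 hy
    -- Inside `F(H)`, the part of `K` in the socle position at `y` falls into `F (W₁ ∪ H \ D)`,
    -- hence below `y` by the splitting; colocality extends this to all of `K`.
    have hKy : K ≤ F (notAbove e Set.univ y) := by
      refine h.le_notAbove_of_inf_le trivial le_top ?_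
      refine le_trans ?_ (h.mono hDo hyo hDy)
      rw [← hK₂]
      refine le_inf ?_ inf_le_left
      refine le_trans ?_ (h.mono (hyo'.inter hHo) h₁o hsub')
      rw [h.inf _ _ hyo' hHo]
      exact le_inf inf_le_right (inf_le_left.trans hKH)
    have hKW : K ≤ F (W₁ ∪ lowerHull e D \ D) := by
      have : K ≤ F (notAbove e D y ∪ lowerHull e D \ D) := by
        refine le_trans ?_ (h.mono (hyo.inter hHo) hDo hsub)
        rw [h.inf _ _ hyo hHo]
        exact le_inf hKy hKH
      exact this.trans (hK₂.ge.trans inf_le_left)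
    have hsub := h.subset_of_le h₂o h₁o (hK₁.ge.trans (sup_le le_rfl hKW))
    refine h₁₂.2 fun v hv => (hsub (Or.inl hv)).resolve_right fun hc => hc.2 (h₂.1 hv)
  edge x y hxy := by
    obtain ⟨P, N, T, -, -, hy, hx, hs⟩ := h.edge x y ⟨trivial, trivial, hxy.2.2⟩
    have hHo : IsOpenIn e Set.univ (lowerHull e D) := isOpenIn_lowerHull
    have hCo := hD.isOpenIn_lowerHull_diff
    have hCH : F (lowerHull e D \ D) ≤ F (lowerHull e D) := h.mono hCo hHo Set.sdiff_subset
    refine ⟨_, _, _, le_sup_right, sup_le inf_le_right hCH, hy.restrict h hD hxy.2.1,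
      hx.restrict h hD hxy.1, ?_⟩
    exact not_splits_restrict hy.1.le hx.1.le ((hx.2 _ hHo).1 (subset_lowerHull hxy.1))
      ((hy.2 _ hCo).2 fun hc => hc.2 hxy.2.1) hCH hs

end Convex

/-! ### The radical series -/

section Radical

theorem radPow_succ_le (i : ℕ) : radPow R M (i + 1) ≤ radPow R M i :=
  Submodule.map_subtype_le _ _

theorem radPow_antitone : Antitone (radPow R M) := antitone_nat_of_succ_le radPow_succ_le

theorem radPow_succ_lt [IsNoetherian R M] {i : ℕ} (h : radPow R M i ≠ ⊥) :
    radPow R M (i + 1) < radPow R M i := by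
  have : Nontrivial (radPow R M i) := Submodule.nontrivial_iff_ne_bot.2 h
  refine lt_of_le_of_ne (radPow_succ_le i) fun hc => ?_
  refine (Module.jacobson_lt_top R (radPow R M i)).ne ?_
  apply Submodule.map_injective_of_injective (radPow R M i).injective_subtype
  rw [Submodule.map_subtype_top]
  exact hc

/-- The descending series stabilizes, and it strictly decreases at every nonzero term because a
nonzero Noetherian module has a proper radical. -/
theorem exists_radPow_eq_bot [IsNoetherian R M] [IsArtinian R M] : ∃ n, radPow R M n = ⊥ := by
  obtain ⟨n, hn⟩ := IsArtinian.monotone_stabilizes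
    (⟨radPow R M, radPow_antitone⟩ : ℕ →o (Submodule R M)ᵒᵈ)
  refine ⟨n, ?_⟩
  by_contra h
  exact (radPow_succ_lt h).ne (hn (n + 1) n.le_succ).symm

/-- A superfluous submodule of a submodule of `rad^i M` is contained in `rad^(i+1) M`. -/
theorem le_radPow_succ {i : ℕ} {N T : Submodule R M} (hNT : N ≤ T) (hT : T ≤ radPow R M i)
    (hs : ∀ K : Submodule R M, T ≤ N ⊔ K → T ≤ K) : N ≤ radPow R M (i + 1) := by
  have hN : (N.comap (radPow R M i).subtype).map (radPow R M i).subtype = N := by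
    rw [Submodule.map_comap_subtype]
    exact inf_eq_right.2 (hNT.trans hT)
  rw [← hN]
  refine Submodule.map_mono (le_sInf fun m hm => ?_)
  by_contra hNm
  -- A maximal submodule `m` missing `N` would supplement it, so superfluity would put `T`, and with
  -- it `N`, inside `m`.
  have htop : N.comap (radPow R M i).subtype ⊔ m = ⊤ :=
    hm.2 _ (right_lt_sup.2 hNm)
  have hTm := hs (m.map (radPow R M i).subtype) (by
    rw [← hN, ← Submodule.map_sup, htop, Submodule.map_subtype_top]
    exact hT)
  refine hNm ((Submodule.comap_mono (hNT.trans hTm)).trans ?_)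
  rw [Submodule.comap_map_eq_of_injective (radPow R M i).injective_subtype]

end Radical

/-! ### Radical layers of vertices -/

namespace VirtualDiagram

variable (𝔇 : VirtualDiagram R M V)

/-- A vertex is in the last radical layer whose radical power contains the submodule it
generates. -/
theorem inRadicalLayer_of_le [Finite V] {x : V} {i : ℕ}
    (h₁ : 𝔇.sub (below 𝔇.edge Set.univ x) ≤ radPow R M i)
    (h₂ : ¬ 𝔇.sub (below 𝔇.edge Set.univ x) ≤ radPow R M (i + 1)) : 𝔇.InRadicalLayer x i := by
  have hcov := 𝔇.isDiagram.strictBelow_covBy (Set.mem_univ x)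
  refine ⟨le_sup_of_le_right (le_inf le_rfl h₁), ?_⟩
  by_contra hc
  -- If the constituent did not lie over `rad^(i+1) M`, the intersection with that power would
  -- supplement the maximal submodule, and locality would contradict `h₂`.
  refine h₂ ((𝔇.isDiagram.below_le_of_le_sup (Set.mem_univ x)
    (bot_le (a := 𝔇.sub (below 𝔇.edge Set.univ x) ⊓ radPow R M (i + 1))) ?_).trans inf_le_right)
  rcases hcov.eq_or_eq le_sup_left (sup_le hcov.le inf_le_left) with h | h
  · exact absurd (sup_eq_left.1 h) hc
  · exact h.ge

/-- The radical powers reach zero while the submodule at `x` is nonzero. The bound `k` is kept so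
that layers of different vertices can be compared. -/
theorem exists_layer [IsNoetherian R M] [IsArtinian R M] (x : V) {k : ℕ}
    (hk : 𝔇.sub (below 𝔇.edge Set.univ x) ≤ radPow R M k) :
    ∃ i ≥ k, 𝔇.sub (below 𝔇.edge Set.univ x) ≤ radPow R M i ∧
      ¬ 𝔇.sub (below 𝔇.edge Set.univ x) ≤ radPow R M (i + 1) := by
  obtain ⟨n, hn⟩ := exists_radPow_eq_bot (R := R) (M := M)
  by_contra! hc
  have key : ∀ j, 𝔇.sub (below 𝔇.edge Set.univ x) ≤ radPow R M (k + j) := by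
    intro j
    induction j with
    | zero => exact hk
    | succ j ih => exact hc (k + j) (by omega) ih
  have h0 : 𝔇.sub (below 𝔇.edge Set.univ x) ≤ ⊥ :=
    hn ▸ (key n).trans (radPow_antitone (by omega))
  exact (𝔇.isDiagram.strictBelow_covBy (Set.mem_univ x)).lt.not_ge (h0.trans bot_le)

/-- Radical layers strictly increase along directed paths. -/
theorem inDifferentLayers_of_transGen [Finite V] [IsNoetherian R M] [IsArtinian R M] {x y : V}
    (h : Relation.TransGen (EdgeIn 𝔇.edge Set.univ) x y) : 𝔇.InDifferentLayers x y := by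
  have hd := 𝔇.isDiagram
  obtain ⟨i, -, hi, hi'⟩ := 𝔇.exists_layer x (k := 0) le_top
  have hy : 𝔇.sub (below 𝔇.edge Set.univ y) ≤ radPow R M (i + 1) := by
    refine (hd.mono (isOpenIn_below trivial) (isOpenIn_strictBelow x)
      ((isOpenIn_strictBelow x).below_subset h)).trans ?_
    exact le_radPow_succ (hd.strictBelow_covBy (Set.mem_univ x)).le hi fun K hK =>
      hd.below_le_of_le_sup (Set.mem_univ x) bot_le hK
  obtain ⟨j, hij, hj, hj'⟩ := 𝔇.exists_layer y hy
  exact ⟨i, j, 𝔇.inRadicalLayer_of_le hi hi', 𝔇.inRadicalLayer_of_le hj hj', by omega⟩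

/-! ### Realizability and convexity -/

theorem realizable_of_isConvex [Finite V] (hD : IsConvex 𝔇.edge D) : 𝔇.Realizable D := by
  refine ⟨_, _, 𝔇.isDiagram.mono hD.isOpenIn_lowerHull_diff isOpenIn_lowerHull Set.sdiff_subset,
    _, 𝔇.isDiagram.restrict hD, fun U x hU hxU hx => ?_⟩
  have h₁ := hxU.union_lowerHull_diff hD
  rw [Set.insert_union] at h₁ ⊢
  refine 𝔇.isDiagram.placedAt_insert (hU.union_lowerHull_diff hD) h₁ ?_
  rintro (hc | hc)
  · exact hx hc
  · exact hc.2 (hxU.1 (Set.mem_insert _ _))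

theorem realizable_singleton [Finite V] (x : V) : 𝔇.Realizable {x} := by
  refine 𝔇.realizable_of_isConvex ?_
  rintro _ rfl _ rfl z h₁ h₂
  rcases Relation.reflTransGen_iff_eq_or_transGen.1 h₁ with h | h
  · exact h
  · exact absurd (h.trans_left h₂) (𝔇.isDiagram.acyclic _)

/-- In a realization of `D`, the vertices of `D` generate what they generate in `M`. -/
theorem below_eq_of_realizes [Finite V] (hG : IsDiagramOf 𝔇.edge D B A G)
    (hp : ∀ U x, IsOpenIn 𝔇.edge D U → IsOpenIn 𝔇.edge D (insert x U) → x ∉ U →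
      PlacedAt 𝔇.edge Set.univ 𝔇.sub (G U) (G (insert x U)) x) {x : V} (hx : x ∈ D) :
    G (below 𝔇.edge D x) = B ⊔ 𝔇.sub (below 𝔇.edge Set.univ x) := by
  have hd := 𝔇.isDiagram
  have hxo : IsOpenIn 𝔇.edge D (below 𝔇.edge D x) := isOpenIn_below hx
  have hxo' : IsOpenIn 𝔇.edge D (strictBelow 𝔇.edge D x) := isOpenIn_strictBelow x
  have hpl := hp _ x hxo' (insert_strictBelow (e := 𝔇.edge) (D := D) x ▸ hxo)
    (hG.notMem_strictBelow x)
  rw [insert_strictBelow] at hpl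
  obtain ⟨hcov, hpl⟩ := hpl
  have h₁ := (hpl _ (isOpenIn_below trivial)).1 (mem_below x)
  have h₂ := (hpl _ (isOpenIn_strictBelow x)).2 (hd.notMem_strictBelow x)
  have h₃ : 𝔇.sub (below 𝔇.edge Set.univ x) ≤ G (below 𝔇.edge D x) := by
    have hcF := hd.strictBelow_covBy (Set.mem_univ x)
    refine (hd.below_le_of_le_sup (Set.mem_univ x) (bot_le (a := G (below 𝔇.edge D x) ⊓
      𝔇.sub (below 𝔇.edge Set.univ x))) ?_).trans inf_le_left
    -- Were `G (below x) ⊓ F (below x)` inside `F (strictBelow x)`, the constituent of `G` at `x`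
    -- would lie both in and over it, hence vanish.
    rcases hcF.eq_or_eq le_sup_left (sup_le hcF.le inf_le_right) with h | h
    · refine absurd (h₁.trans (sup_le le_rfl ?_)) hcov.lt.not_ge
      exact (le_inf inf_le_left (sup_eq_left.1 h)).trans h₂
    · exact h.ge
  refine le_antisymm ?_ (sup_le (hG.lower_le hxo) h₃)
  refine hG.below_le_of_le_sup hx le_sup_left (h₁.trans (sup_le_sup_left ?_ _))
  exact inf_le_right.trans le_sup_right

/-- In a realization of `D`, the vertices of `D` cogenerate what they cogenerate in `M`. -/
theorem notAbove_eq_of_realizes [Finite V] (hG : IsDiagramOf 𝔇.edge D B A G)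
    (hp : ∀ U x, IsOpenIn 𝔇.edge D U → IsOpenIn 𝔇.edge D (insert x U) → x ∉ U →
      PlacedAt 𝔇.edge Set.univ 𝔇.sub (G U) (G (insert x U)) x) {y : V} (hy : y ∈ D) :
    G (notAbove 𝔇.edge D y) = A ⊓ 𝔇.sub (notAbove 𝔇.edge Set.univ y) := by
  have hd := 𝔇.isDiagram
  have hyo : IsOpenIn 𝔇.edge D (notAbove 𝔇.edge D y) := isOpenIn_notAbove y
  obtain ⟨hcov, hpl⟩ := hp _ y hyo (isOpenIn_insert_notAbove hy hG.acyclic) (notMem_notAbove y)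
  have h₁ := (hpl _ (isOpenIn_insert_notAbove trivial hd.acyclic)).1 (Set.mem_insert _ _)
  have h₂ := (hpl _ (isOpenIn_notAbove y)).2 (notMem_notAbove y)
  refine le_antisymm (le_inf (hG.le_upper hyo) ?_) ?_
  · have hcF := hd.notAbove_covBy (Set.mem_univ y)
    refine le_sup_left.trans (hd.le_notAbove_of_inf_le (Set.mem_univ y) (le_top
      (a := G (notAbove 𝔇.edge D y) ⊔ 𝔇.sub (notAbove 𝔇.edge Set.univ y))) ?_)
    rcases hcF.eq_or_eq (le_inf le_sup_right hcF.le) inf_le_right with h | h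
    · exact h.le
    · refine absurd (h₁.trans (sup_le le_rfl ?_)) hcov.lt.not_ge
      refine (le_inf (inf_le_right.trans (inf_eq_right.1 h)) inf_le_left).trans ?_
      rw [sup_inf_assoc_of_le _ hcov.le]
      exact sup_le le_rfl (inf_comm (𝔇.sub (notAbove 𝔇.edge Set.univ y)) _ ▸ h₂)
  · refine hG.le_notAbove_of_inf_le hy inf_le_left (le_trans (le_inf inf_le_right ?_) h₂)
    exact inf_le_left.trans inf_le_right

/-- A missing vertex `z` between `x` and `y` is squeezed out: what it generates is contained in `A`
because of `x`, has no head left in `A / B`, so falls into `B`, and thereby cannot reach `y`. -/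
theorem Realizable.isConvex [Finite V] {𝔇 : VirtualDiagram R M V} (h : 𝔇.Realizable D) :
    IsConvex 𝔇.edge D := by
  obtain ⟨B, A, -, G, hG, hp⟩ := h
  have hd := 𝔇.isDiagram
  intro x hx y hy z hxz hzy
  by_contra hz
  have hzo : IsOpenIn 𝔇.edge Set.univ (below 𝔇.edge Set.univ z) := isOpenIn_below trivial
  have hDo : IsOpenIn 𝔇.edge D (D ∩ below 𝔇.edge Set.univ z) :=
    ⟨Set.inter_subset_left, fun a b hab ha =>
      ⟨hab.2.1, hzo.2 a b ⟨trivial, trivial, hab.2.2⟩ ha.2⟩⟩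
  have hzA : 𝔇.sub (below 𝔇.edge Set.univ z) ≤ A := by
    refine (hd.mono hzo (isOpenIn_below trivial)
      ((isOpenIn_below (Set.mem_univ x)).below_subset hxz)).trans
      (le_trans ?_ (hG.le_upper (isOpenIn_below hx)))
    rw [𝔇.below_eq_of_realizes hG hp hx]
    exact le_sup_right
  have h₁ : 𝔇.sub (below 𝔇.edge Set.univ z) ≤ G (D ∩ below 𝔇.edge Set.univ z) := by
    refine hG.le_of_le_notAbove hDo hzA fun v hv hvz => ?_
    rw [𝔇.notAbove_eq_of_realizes hG hp hv]
    exact le_inf hzA (hd.mono hzo (isOpenIn_notAbove v)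
      (hzo.subset_notAbove fun hc => hvz ⟨hv, hc⟩))
  -- Here `z ∉ D` enters: every vertex of `D` below `z` is strictly below it.
  have h₂ : G (D ∩ below 𝔇.edge Set.univ z) ≤ 𝔇.sub (strictBelow 𝔇.edge Set.univ z) ⊔ B := by
    refine hG.le_of_below_le hDo le_sup_right fun v hv => ?_
    rw [𝔇.below_eq_of_realizes hG hp hv.1]
    refine sup_le le_sup_right (le_sup_of_le_left ?_)
    refine hd.mono (isOpenIn_below trivial) (isOpenIn_strictBelow z)
      ((isOpenIn_strictBelow z).below_subset ?_)
    rcases Relation.reflTransGen_iff_eq_or_transGen.1 hv.2 with h | h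
    · exact absurd (h ▸ hv.1) hz
    · exact h
  have h₃ : 𝔇.sub (below 𝔇.edge Set.univ z) ≤ B :=
    hd.below_le_of_le_sup (Set.mem_univ z) bot_le (h₁.trans h₂)
  have h₄ : B ≤ 𝔇.sub (notAbove 𝔇.edge Set.univ y) := by
    have := hG.lower_le (isOpenIn_notAbove y)
    rw [𝔇.notAbove_eq_of_realizes hG hp hy] at this
    exact this.trans inf_le_right
  exact (hd.subset_of_le hzo (isOpenIn_notAbove y) (h₃.trans h₄) (mem_below z)).2 hzy

/-! ### Generalized paths and directed paths -/

/-- Every vertex where a generalized path enters a generalized vertex lies on a directed path with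
the same ends. -/
theorem IsGeneralizedPath.exists_mem {𝔇 : VirtualDiagram R M V} {x y : V} {m : ℕ}
    {K : Fin (m + 1) → Set V} (h : 𝔇.IsGeneralizedPath x y m K) (i : Fin (m + 1)) :
    ∃ z ∈ K i, Relation.ReflTransGen (EdgeIn 𝔇.edge Set.univ) x z ∧
      Relation.ReflTransGen (EdgeIn 𝔇.edge Set.univ) z y := by
  obtain ⟨h0, hm, -, a, b, hab, hba⟩ := h
  have hstep : ∀ j : Fin m, Relation.ReflTransGen (EdgeIn 𝔇.edge Set.univ)
      (a j.castSucc) (a j.succ) := fun j =>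
    (reach_mono (Set.subset_univ _) (hab j.castSucc).2.2).tail ⟨trivial, trivial, hba j⟩
  refine ⟨a i, (hab i).1, ?_, ?_⟩
  · have ha0 : a 0 = x := by simpa [h0] using (hab 0).1
    rw [← ha0]
    induction i using Fin.induction with
    | zero => exact Relation.ReflTransGen.refl
    | succ j ih => exact ih.trans (hstep j)
  · have ham : a (Fin.last m) = y := by simpa [hm] using (hab (Fin.last m)).1
    rw [← ham]
    induction i using Fin.reverseInduction with
    | last => exact Relation.ReflTransGen.refl
    | cast j ih => exact (hstep j).trans ih

/-- A directed path is a generalized path whose generalized vertices are its vertices. -/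
theorem exists_isGeneralizedPath [Finite V] {x y z : V}
    (hxz : Relation.ReflTransGen (EdgeIn 𝔇.edge Set.univ) x z)
    (hzy : Relation.ReflTransGen (EdgeIn 𝔇.edge Set.univ) z y) :
    ∃ (m : ℕ) (K : Fin (m + 1) → Set V), 𝔇.IsGeneralizedPath x y m K ∧ ∃ i, K i = {z} := by
  obtain ⟨m, p, hp0, hpm, hp⟩ := exists_seq_of_reach hxz
  obtain ⟨n, q, hq0, hqn, hq⟩ := exists_seq_of_reach hzy
  -- The concatenation of the two paths; they agree at index `m`, where both are at `z`.
  let r : ℕ → V := fun i => if i ≤ m then p i else q (i - m)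
  have hrq : ∀ j, r (m + j) = q j := by
    intro j
    rcases Nat.eq_zero_or_pos j with rfl | hj
    · simp [r, hpm, hq0]
    · simp [r, show ¬ m + j ≤ m by omega]
  have hr : ∀ i < m + n, 𝔇.edge (r i) (r (i + 1)) := by
    intro i hi
    rcases lt_or_ge i m with h | h
    · simpa [r, h.le, Nat.succ_le_of_lt h] using hp i h
    · obtain ⟨j, rfl⟩ := Nat.exists_eq_add_of_le h
      rw [add_assoc, hrq, hrq]
      exact hq j (by omega)
  refine ⟨m + n, fun i => {r i}, ⟨?_, ?_, fun i => 𝔇.realizable_singleton _, fun i => r i,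
    fun i => r i, fun i => ⟨rfl, rfl, Relation.ReflTransGen.refl⟩, fun i => hr i i.2⟩,
    ⟨⟨m, by omega⟩, ?_⟩⟩
  · simp [r, hp0]
  · simp [hrq, hqn]
  · simp [r, hpm]

end VirtualDiagram

end Diagram

end VirtualDiagrams

theorem mainTheorem4 {R : Type*} [Ring R] {M : Type*} [AddCommGroup M] [Module R M]
    [IsNoetherian R M] [IsArtinian R M] {V : Type*} [Finite V]
    (𝔇 : VirtualDiagrams.VirtualDiagram R M V) (D : Set V)
    (hD : VirtualDiagrams.IsConnectedSubdiagram 𝔇.edge D) :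
    𝔇.Realizable D ↔
      ¬ ∃ x ∈ D, ∃ y ∈ D, 𝔇.InDifferentLayers x y ∧
        ∃ (m : ℕ) (K : Fin (m + 1) → Set V),
          𝔇.IsGeneralizedPath x y m K ∧ ∃ i, Disjoint (K i) D := by
  constructor
  · rintro h ⟨x, hx, y, hy, -, m, K, hK, i, hi⟩
    obtain ⟨z, hz, hxz, hzy⟩ := hK.exists_mem i
    exact Set.disjoint_left.1 hi hz (h.isConvex x hx y hy z hxz hzy)
  · intro h
    refine 𝔇.realizable_of_isConvex fun x hx y hy z hxz hzy => ?_
    by_contra hz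
    obtain ⟨m, K, hK, i, hi⟩ := 𝔇.exists_isGeneralizedPath hxz hzy
    -- Since `x ∈ D` and `z ∉ D`, the path through `z` is nontrivial, so its ends are in different
    -- layers.
    refine h ⟨x, hx, y, hy, 𝔇.inDifferentLayers_of_transGen ?_, m, K, hK, i, ?_⟩
    · rcases Relation.reflTransGen_iff_eq_or_transGen.1 hxz with hzx | hxz
      · exact absurd (hzx ▸ hx) hz
      · exact hxz.trans_left hzy
    · rw [hi]
      exact Set.disjoint_singleton_left.2 hz
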